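/- **Definitions.** A *quantum metric* on a von Neumann algebra $\mathcal M\subseteq\mathcal B(\mathcal H)$ is a family $\mathbb V=\{\mathcal V_t\}_{t\in[0,\infty)}$ of weak*-closed self-adjoint subspaces of $\mathcal B(\mathcal H)$ with $\mathcal V_0=\mathcal M'$, $\mathcal V_s\mathcal V_t\subseteq\mathcal V_{s+t}$ and $\mathcal V_t=\bigcap_{s>t}\mathcal V_s$ for all $s,t\ge 0$. It is *reflexive* if for every $t$ one has $\mathcal V_t=\{B\in\mathcal B(\mathcal H) : P\mathcal V_tQ=\{0\}\Rightarrow PBQ=0\}$, with $P,Q$ ranging over the (orthogonal) projections of $\mathcal B(\mathcal H)$. Let $\mathcal M\overline\otimes\mathcal B(\ell_2)$ be the weak*-closure of the algebraic tensor product in $\mathcal B(\mathcal H\otimes_2\ell_2)$, and identify $\mathcal M$ with $\mathcal M\otimes\mathrm{id}$. For projections $P,Q\in\mathcal M\overline\otimes\mathcal B(\ell_2)$ put $\operatorname{dist}(P,Q)=\inf\{t : P(A\otimes\mathrm{id})Q\ne0\text{ for some }A\in\mathcal V_t\}\in[0,\infty]$ ($\inf\emptyset=\infty$). For a projection $P\in\mathcal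 M$ and $\varepsilon>0$ put $$\operatorname{diam}(P)=\sup\{\operatorname{dist}(Q,R) : Q,R\text{ projections in }\mathcal M\overline\otimes\mathcal B(\ell_2),\ Q(PAP\otimes\mathrm{id})R\neq0\text{ for some }A\in\mathcal B(\mathcal H)\},$$ with $\operatorname{diam}(0)=0$, and $$(P)_\varepsilon=\mathrm{id}-\bigvee\{Q\in\mathcal M\text{ a projection} : \operatorname{dist}(P,Q)\ge\varepsilon\}.$$ A family $\mathscr P$ of projections in $\mathcal M$ is *$r$-disjoint* if $(P)_r(Q)_r=0$ for all distinct $P,Q\in\mathscr P$, and *uniformly bounded* if $\sup_{P\in\mathscr P}\operatorname{diam}(P)<\infty$. One writes $\operatorname{asdim}(\mathcal M)\le n$ if for every $r>0$ there are uniformly bounded, $r$-disjoint families $\mathscr P^0,\dots,\mathscr P^n$ of projections in $\mathcal M$ with $\bigvee\bigcup_{i=0}^n\mathscr P^i=\mathrm{id}$; $\operatorname{asdim}(\mathcal M)\in\{0,1,2,\dots\}\cup\{\infty\}$ is the least such $n$ ($\infty$ if there is none). For a central projection $R$ of $\mathcal M$, the corresponding *metric quotient* of $(\mathcal M,\mathbb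 V)$ is the von Neumann algebra $R\mathcal M\subseteq\mathcal B(R\mathcal H)$ with the quantum metric $\{R\mathcal V_tR\}_{t\in[0,\infty)}$. **Theorem.** Let $\mathcal M$ be a von Neumann algebra with a reflexive quantum metric, and let $\mathcal N_1$ and $\mathcal N_2$ be the metric quotients of $\mathcal M$ corresponding to central projections $R_1$ and $R_2$ of $\mathcal M$. If $R_1\vee R_2=\mathrm{id}$, then $$\operatorname{asdim}(\mathcal M)\le\max\{\operatorname{asdim}(\mathcal N_1),\operatorname{asdim}(\mathcal N_2)\}.$$ -/

import Mathlib

open scoped NNReal ENNReal TensorProduct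

noncomputable section

namespace QMetric

/-! ### Hilbert space tensor product with `ℓ²` and the weak* topology -/

/-- The Hilbert space `ℓ²` of square summable complex sequences. -/
abbrev EllTwo : Type := lp (fun _ : ℕ => ℂ) 2

/-- The Hilbert space tensor product `H ⊗₂ ℓ²`. -/
abbrev HilbertTensor (H : Type*) [NormedAddCommGroup H] [InnerProductSpace ℂ H] : Type _ :=
  UniformSpace.Completion (H ⊗[ℂ] EllTwo)

section Basic

variable {H : Type*} [NormedAddCommGroup H] [InnerProductSpace ℂ H]

/-- The bounded operator `A ⊗ B` on `H ⊗₂ ℓ²`. -/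
def tensor (A : H →L[ℂ] H) (B : EllTwo →L[ℂ] EllTwo) : HilbertTensor H →L[ℂ] HilbertTensor H :=
  (TensorProduct.mapL A B).completion

variable (H) in
/-- The weak* (ultraweak) topology of `B(H)`, `B(H)` being the dual of the space of trace class
operators: the initial topology for the functionals `A ↦ ∑ₙ ⟪xₙ, A yₙ⟫` with
`∑ₙ ‖xₙ‖² < ∞` and `∑ₙ ‖yₙ‖² < ∞`. -/
abbrev weakStarTopology : TopologicalSpace (H →L[ℂ] H) :=
  ⨅ p : lp (fun _ : ℕ => H) 2 × lp (fun _ : ℕ => H) 2,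
    TopologicalSpace.induced (fun A : H →L[ℂ] H => ∑' n, inner ℂ (p.1 n) (A (p.2 n)))
      inferInstance

/-- `(A ⊗ id)(B ⊗ id) = AB ⊗ id`. -/
theorem tensor_one_mul (A B : H →L[ℂ] H) : tensor (A * B) 1 = tensor A 1 * tensor B 1 := by
  ext x
  induction x using UniformSpace.Completion.induction_on with
  | hp => exact isClosed_eq (ContinuousLinearMap.continuous _) (ContinuousLinearMap.continuous _)
  | ih a =>
    have h : TensorProduct.mapL (A * B) (1 : EllTwo →L[ℂ] EllTwo)
        = TensorProduct.mapL A 1 * TensorProduct.mapL B 1 := by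
      rw [← TensorProduct.mapL_mul, one_mul]
    simp [tensor, h]

theorem tensor_one_eq_zero {A : H →L[ℂ] H} : tensor A 1 = 0 ↔ A = 0 := by
  constructor
  · intro h
    ext x
    have h1 := congrArg (fun T => T ((x ⊗ₜ[ℂ] (lp.single 2 0 (1 : ℂ) : EllTwo) :
      H ⊗[ℂ] EllTwo) : HilbertTensor H)) h
    have h2 := congrArg norm h1
    simp [tensor, lp.norm_single] at h2
    simpa using h2
  · rintro rfl
    ext x
    induction x using UniformSpace.Completion.induction_on with
    | hp => exact isClosed_eq (ContinuousLinearMap.continuous _) (ContinuousLinearMap.continuous _)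
    | ih a => simp [tensor]

end Basic

section Main

variable {H : Type*} [NormedAddCommGroup H] [InnerProductSpace ℂ H] [CompleteSpace H]

/-- The join of a set of projections: the orthogonal projection onto the closed linear span of
their ranges. -/
def projSup (S : Set (H →L[ℂ] H)) : H →L[ℂ] H :=
  (⨆ P ∈ S, P.range).topologicalClosure.starProjection

/-- The set of (orthogonal) projections in a von Neumann algebra. -/
def projections (M : VonNeumannAlgebra H) : Set (H →L[ℂ] H) :=
  {P | P ∈ M ∧ IsStarProjection P}

/-- The normal spatial tensor product of `M` and `B(ℓ²)`: the weak*-closure of the algebraic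
tensor product in `B(H ⊗₂ ℓ²)`. -/
def amplification (M : VonNeumannAlgebra H) : Set (HilbertTensor H →L[ℂ] HilbertTensor H) :=
  @closure _ (weakStarTopology (HilbertTensor H))
    (Submodule.span ℂ {T | ∃ A ∈ M, ∃ B : EllTwo →L[ℂ] EllTwo, T = tensor A B} :
      Set (HilbertTensor H →L[ℂ] HilbertTensor H))

/-- The projections in the normal spatial tensor product of `M` and `B(ℓ²)`. -/
def ampProjections (M : VonNeumannAlgebra H) : Set (HilbertTensor H →L[ℂ] HilbertTensor H) :=
  {P | P ∈ amplification M ∧ IsStarProjection P}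

/-- A quantum metric on a von Neumann algebra `M ⊆ B(H)`. -/
structure QuantumMetric (M : VonNeumannAlgebra H) where
  /-- The weak*-closed subspace of operators of displacement at most `t`. -/
  V : ℝ≥0 → Submodule ℂ (H →L[ℂ] H)
  isClosed_V : ∀ t, @IsClosed _ (weakStarTopology H) (V t : Set (H →L[ℂ] H))
  V_zero : (V 0 : Set (H →L[ℂ] H)) = M.commutant
  star_mem_V : ∀ t, ∀ A ∈ V t, star A ∈ V t
  mul_mem_V : ∀ s t, ∀ A ∈ V s, ∀ B ∈ V t, A * B ∈ V (s + t)
  V_eq_iInf : ∀ t, V t = ⨅ s ∈ Set.Ioi t, V s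

/-- A subspace of `B(H)` is (operator) reflexive if it contains every operator `B` such that
`P B Q = 0` for all projections `P`, `Q` of `B(H)` with `P 𝒱 Q = {0}`. -/
def OperatorReflexive (W : Submodule ℂ (H →L[ℂ] H)) : Prop :=
  (W : Set (H →L[ℂ] H)) = {B | ∀ P Q : H →L[ℂ] H, IsStarProjection P → IsStarProjection Q →
    (∀ A ∈ W, P * A * Q = 0) → P * B * Q = 0}

namespace QuantumMetric

variable {M : VonNeumannAlgebra H} (𝕍 : QuantumMetric M)

/-- A quantum metric is reflexive if all its subspaces are. -/
def IsReflexive : Prop := ∀ t, OperatorReflexive (𝕍.V t)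

/-- The distance between projections of `M`; it is `∞` if there is no admissible `t`. -/
def dist (P Q : H →L[ℂ] H) : ℝ≥0∞ :=
  ⨅ (t : ℝ≥0) (_ : ∃ A ∈ 𝕍.V t, P * A * Q ≠ 0), (t : ℝ≥0∞)

/-- The distance between projections of the normal spatial tensor product of `M` and `B(ℓ²)`. -/
def ampDist (P Q : HilbertTensor H →L[ℂ] HilbertTensor H) : ℝ≥0∞ :=
  ⨅ (t : ℝ≥0) (_ : ∃ A ∈ 𝕍.V t, P * tensor A 1 * Q ≠ 0), (t : ℝ≥0∞)

/-- The two distances agree under the identification of `M` with `M ⊗ id`. -/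
theorem ampDist_tensor_one (P Q : H →L[ℂ] H) :
    𝕍.ampDist (tensor P 1) (tensor Q 1) = 𝕍.dist P Q := by
  simp only [ampDist, dist, ← tensor_one_mul, ne_eq, tensor_one_eq_zero]

/-- The diameter of a projection `P` in `M`. For `P = 0` the supremum is over the empty set and
the diameter is `0`. -/
def diam (P : H →L[ℂ] H) : ℝ≥0∞ :=
  sSup {d | ∃ Q ∈ ampProjections M, ∃ R ∈ ampProjections M,
    (∃ A : H →L[ℂ] H, Q * tensor (P * A * P) 1 * R ≠ 0) ∧ d = 𝕍.ampDist Q R}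

theorem diam_zero : 𝕍.diam 0 = 0 := by
  have h : tensor (0 : H →L[ℂ] H) 1 = 0 := tensor_one_eq_zero.2 rfl
  simp [diam, h]

/-- The open `ε`-neighborhood `(P)_ε` of a projection `P` in `M`. -/
def nhd (P : H →L[ℂ] H) (ε : ℝ≥0) : H →L[ℂ] H :=
  1 - projSup {Q | Q ∈ projections M ∧ (ε : ℝ≥0∞) ≤ 𝕍.dist P Q}

/-- A family of projections is `r`-disjoint if the open `r`-neighborhoods of any two distinct
members have product zero. -/
def IsDisjointFamily (r : ℝ≥0) (F : Set (H →L[ℂ] H)) : Prop :=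
  ∀ P ∈ F, ∀ Q ∈ F, P ≠ Q → 𝕍.nhd P r * 𝕍.nhd Q r = 0

/-- A family of projections is uniformly bounded if the diameters of its members have a common
finite bound. -/
def IsUniformlyBounded (F : Set (H →L[ℂ] H)) : Prop :=
  ∃ R : ℝ≥0, 0 < R ∧ ∀ P ∈ F, 𝕍.diam P ≤ R

/-- `asdim(M) ≤ n`. -/
def AsdimLE (n : ℕ) : Prop :=
  ∀ r : ℝ≥0, 0 < r → ∃ F : Fin (n + 1) → Set (H →L[ℂ] H),
    (∀ i, F i ⊆ projections M ∧ 𝕍.IsUniformlyBounded (F i) ∧ 𝕍.IsDisjointFamily r (F i)) ∧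
    projSup (⋃ i, F i) = 1

/-- The asymptotic dimension: the least `n` with `asdim(M) ≤ n`, and `∞` if there is none. -/
def asdim : ℕ∞ := ⨅ (n : ℕ) (_ : 𝕍.AsdimLE n), (n : ℕ∞)

end QuantumMetric

/-! ### Metric quotients -/

/-- A central projection of the von Neumann algebra `M`. -/
structure CentralProjection (M : VonNeumannAlgebra H) where
  /-- The underlying operator. -/
  op : H →L[ℂ] H
  isStarProjection : IsStarProjection op
  mem : op ∈ M
  mem_commutant : op ∈ M.commutant

namespace CentralProjection

variable {M : VonNeumannAlgebra H} (R : CentralProjection M)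

/-- The range of the central projection, a closed subspace of `H`. -/
def space : Submodule ℂ H := R.op.range

theorem op_comp_op (x : H) : R.op (R.op x) = R.op x :=
  DFunLike.congr_fun R.isStarProjection.isIdempotentElem x

theorem mem_space {x : H} : x ∈ R.space ↔ R.op x = x := by
  constructor
  · rintro ⟨y, rfl⟩
    exact R.op_comp_op y
  · intro h
    exact ⟨x, h⟩

instance : CompleteSpace R.space := by
  have h : IsClosed (R.space : Set H) := by
    have : (R.space : Set H) = {x | R.op x = x} := by
      ext x
      exact R.mem_space
    rw [this]
    exact isClosed_eq R.op.continuous continuous_id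
  exact h.completeSpace_coe

theorem starProjection_space : R.space.starProjection = R.op := by
  obtain ⟨h1, h2⟩ := isStarProjection_iff_eq_starProjection_range.1 R.isStarProjection
  exact h2.symm

/-- The compression of an operator on `H` to the range of `R`, i.e. `R A R` restricted to it. -/
def compress (A : H →L[ℂ] H) : R.space →L[ℂ] R.space :=
  R.space.orthogonalProjectionOnto ∘L A ∘L R.space.subtypeL

/-- The extension by zero of an operator on the range of `R` to an operator on `H`. -/
def inflate (T : R.space →L[ℂ] R.space) : H →L[ℂ] H :=
  R.space.subtypeL ∘L T ∘L R.space.orthogonalProjectionOnto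

theorem inflate_compress (A : H →L[ℂ] H) : R.inflate (R.compress A) = R.op * A * R.op := by
  rw [← R.starProjection_space]
  rfl

theorem compress_inflate (T : R.space →L[ℂ] R.space) : R.compress (R.inflate T) = T := by
  ext x
  simp [compress, inflate]

theorem inflate_injective : Function.Injective R.inflate :=
  Function.LeftInverse.injective R.compress_inflate

theorem inflate_mul (S T : R.space →L[ℂ] R.space) :
    R.inflate (S * T) = R.inflate S * R.inflate T := by
  ext x
  simp [inflate]

theorem inflate_add (S T : R.space →L[ℂ] R.space) :
    R.inflate (S + T) = R.inflate S + R.inflate T := by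
  ext x
  simp [inflate]

theorem inflate_smul (c : ℂ) (T : R.space →L[ℂ] R.space) :
    R.inflate (c • T) = c • R.inflate T := by
  ext x
  simp [inflate]

theorem inflate_zero : R.inflate 0 = 0 := by
  ext x
  simp [inflate]

theorem inflate_one : R.inflate 1 = R.op := by
  rw [← R.starProjection_space]
  rfl

theorem inflate_star (T : R.space →L[ℂ] R.space) :
    R.inflate (star T) = star (R.inflate T) := by
  simp [inflate, ContinuousLinearMap.star_eq_adjoint, ContinuousLinearMap.adjoint_comp,
    Submodule.adjoint_subtypeL, Submodule.adjoint_orthogonalProjectionOnto,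
    ContinuousLinearMap.comp_assoc]

theorem op_mul_op : R.op * R.op = R.op := R.isStarProjection.isIdempotentElem

theorem op_mul_inflate (T : R.space →L[ℂ] R.space) : R.op * R.inflate T = R.inflate T := by
  rw [← R.inflate_one, ← R.inflate_mul, one_mul]

theorem inflate_mul_op (T : R.space →L[ℂ] R.space) : R.inflate T * R.op = R.inflate T := by
  rw [← R.inflate_one, ← R.inflate_mul, mul_one]

/-- If `R` commutes with `A`, then multiplying by `A` and by its compression is the same. -/
theorem inflate_compress_mul {A : H →L[ℂ] H} (hA : R.op * A = A * R.op)
    (T : R.space →L[ℂ] R.space) : R.inflate (R.compress A * T) = A * R.inflate T := by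
  rw [R.inflate_mul, R.inflate_compress, hA, mul_assoc A, R.op_mul_op, mul_assoc,
    R.op_mul_inflate]

theorem inflate_mul_compress {A : H →L[ℂ] H} (hA : R.op * A = A * R.op)
    (T : R.space →L[ℂ] R.space) : R.inflate (T * R.compress A) = R.inflate T * A := by
  rw [R.inflate_mul, R.inflate_compress, mul_assoc R.op, ← hA, ← mul_assoc R.op, R.op_mul_op,
    ← mul_assoc, R.inflate_mul_op]

theorem comm_of_mem {A : H →L[ℂ] H} (hA : A ∈ M) : R.op * A = A * R.op :=
  (VonNeumannAlgebra.mem_commutant_iff.1 R.mem_commutant A hA).symm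

theorem comm_of_mem_commutant {A : H →L[ℂ] H} (hA : A ∈ M.commutant) : R.op * A = A * R.op :=
  VonNeumannAlgebra.mem_commutant_iff.1 hA R.op R.mem

theorem exists_compress_iff {T : R.space →L[ℂ] R.space} :
    (∃ A ∈ M, R.compress A = T) ↔ R.inflate T ∈ M := by
  constructor
  · rintro ⟨A, hA, rfl⟩
    rw [R.inflate_compress]
    exact mul_mem (mul_mem R.mem hA) R.mem
  · intro h
    exact ⟨_, h, R.compress_inflate T⟩

theorem commutes_iff {T : R.space →L[ℂ] R.space} :
    (∀ A ∈ M, R.compress A * T = T * R.compress A) ↔ R.inflate T ∈ M.commutant := by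
  rw [VonNeumannAlgebra.mem_commutant_iff]
  refine forall₂_congr fun A hA => ?_
  rw [← R.inflate_injective.eq_iff, R.inflate_compress_mul (R.comm_of_mem hA),
    R.inflate_mul_compress (R.comm_of_mem hA)]

/-- The von Neumann algebra `R M`, acting on the range of `R`. -/
def algebra : VonNeumannAlgebra R.space where
  carrier := {T | ∃ A ∈ M, R.compress A = T}
  mul_mem' := by
    simp only [Set.mem_ofPred_eq, R.exists_compress_iff, R.inflate_mul]
    exact fun h h' => mul_mem h h'
  one_mem' := by
    simp only [Set.mem_ofPred_eq, R.exists_compress_iff, R.inflate_one]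
    exact R.mem
  add_mem' := by
    simp only [Set.mem_ofPred_eq, R.exists_compress_iff, R.inflate_add]
    exact fun h h' => add_mem h h'
  zero_mem' := by
    simp only [Set.mem_ofPred_eq, R.exists_compress_iff, R.inflate_zero]
    exact zero_mem M
  algebraMap_mem' := by
    intro c
    simp only [Set.mem_ofPred_eq, R.exists_compress_iff, Algebra.algebraMap_eq_smul_one,
      R.inflate_smul, R.inflate_one]
    exact M.toStarSubalgebra.smul_mem R.mem c
  star_mem' := by
    simp only [Set.mem_ofPred_eq, R.exists_compress_iff, R.inflate_star]
    exact fun h => star_mem h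
  centralizer_centralizer' := by
    refine Set.Subset.antisymm ?_ Set.subset_centralizer_centralizer
    intro T hT
    refine R.exists_compress_iff.2 ?_
    suffices h : R.inflate T ∈ M.commutant.commutant by rwa [M.commutant_commutant] at h
    rw [VonNeumannAlgebra.mem_commutant_iff]
    intro C hC
    have hRC := R.comm_of_mem_commutant hC
    have h : R.compress C ∈ Set.centralizer {T | ∃ A ∈ M, R.compress A = T} := by
      rintro _ ⟨A, hA, rfl⟩
      refine R.commutes_iff.2 ?_ A hA
      rw [R.inflate_compress]
      exact mul_mem (mul_mem R.mem_commutant hC) R.mem_commutant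
    have h2 := congrArg R.inflate (hT _ h)
    rwa [R.inflate_compress_mul hRC, R.inflate_mul_compress hRC] at h2

theorem mem_algebra {T : R.space →L[ℂ] R.space} :
    T ∈ R.algebra ↔ ∃ A ∈ M, R.compress A = T := Iff.rfl

theorem mem_algebra_commutant {T : R.space →L[ℂ] R.space} :
    T ∈ R.algebra.commutant ↔ R.inflate T ∈ M.commutant := by
  rw [← R.commutes_iff, VonNeumannAlgebra.mem_commutant_iff]
  simp only [R.mem_algebra]
  exact ⟨fun h A hA => h _ ⟨A, hA, rfl⟩, by rintro h _ ⟨A, hA, rfl⟩; exact h A hA⟩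

/-- Applying `orthogonalProjectionOnto R.space` termwise to a square summable sequence. -/
def restrictSeq (x : lp (fun _ : ℕ => H) 2) : lp (fun _ : ℕ => R.space) 2 :=
  ⟨fun n => R.space.orthogonalProjectionOnto (x n),
    memℓp_gen <| ((lp.memℓp x).summable (by norm_num)).of_nonneg_of_le
      (fun n => Real.rpow_nonneg (norm_nonneg _) _) fun n =>
        Real.rpow_le_rpow (norm_nonneg _) (R.space.norm_orthogonalProjectionOnto_apply_le (x n))
          (by norm_num)⟩

theorem continuous_inflate :
    @Continuous _ _ (weakStarTopology R.space) (weakStarTopology H) R.inflate := by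
  let _ := weakStarTopology R.space
  refine continuous_iInf_rng.2 fun p => continuous_induced_rng.2 ?_
  have h : ((fun A : H →L[ℂ] H => ∑' n, inner ℂ (p.1 n) (A (p.2 n))) ∘ R.inflate)
      = fun T : R.space →L[ℂ] R.space =>
        ∑' n, inner ℂ (R.restrictSeq p.1 n) (T (R.restrictSeq p.2 n)) := by
    ext T
    refine tsum_congr fun n => ?_
    simp [inflate, restrictSeq]
  rw [h]
  exact continuous_iInf_dom (i := (R.restrictSeq p.1, R.restrictSeq p.2)) continuous_induced_dom

end CentralProjection

namespace QuantumMetric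

variable {M : VonNeumannAlgebra H} (𝕍 : QuantumMetric M)

theorem op_mem_V (R : CentralProjection M) (t : ℝ≥0) : R.op ∈ 𝕍.V t := by
  have h0 : R.op ∈ 𝕍.V 0 := by
    rw [← SetLike.mem_coe, 𝕍.V_zero]
    exact R.mem_commutant
  rcases eq_or_lt_of_le (show 0 ≤ t from bot_le) with rfl | ht
  · exact h0
  · rw [𝕍.V_eq_iInf 0] at h0
    simp only [Submodule.mem_iInf] at h0
    exact h0 t ht

theorem exists_compress_mem_V_iff (R : CentralProjection M) {t : ℝ≥0}
    {T : R.space →L[ℂ] R.space} : (∃ A ∈ 𝕍.V t, R.compress A = T) ↔ R.inflate T ∈ 𝕍.V t := by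
  constructor
  · rintro ⟨A, hA, rfl⟩
    have h0 : R.op ∈ 𝕍.V 0 := 𝕍.op_mem_V R 0
    have h := 𝕍.mul_mem_V _ _ _ (𝕍.mul_mem_V _ _ _ h0 _ hA) _ h0
    rwa [zero_add, add_zero, ← R.inflate_compress] at h
  · intro h
    exact ⟨_, h, R.compress_inflate T⟩

/-- The metric quotient of `(M, 𝕍)` corresponding to the central projection `R`: the von Neumann
algebra `R M` with the quantum metric `R 𝒱_t R`, both acting on the range of `R`. -/
def quotient (R : CentralProjection M) : QuantumMetric R.algebra where
  V t :=
    { carrier := {T | ∃ A ∈ 𝕍.V t, R.compress A = T}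
      add_mem' := by
        simp only [Set.mem_ofPred_eq, 𝕍.exists_compress_mem_V_iff, R.inflate_add]
        exact fun h h' => add_mem h h'
      zero_mem' := by
        simp only [Set.mem_ofPred_eq, 𝕍.exists_compress_mem_V_iff, R.inflate_zero]
        exact zero_mem _
      smul_mem' := by
        simp only [Set.mem_ofPred_eq, 𝕍.exists_compress_mem_V_iff, R.inflate_smul]
        exact fun c _ h => Submodule.smul_mem _ c h }
  isClosed_V t := by
    have h : {T | ∃ A ∈ 𝕍.V t, R.compress A = T} = R.inflate ⁻¹' (𝕍.V t) := by
      ext T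
      exact 𝕍.exists_compress_mem_V_iff R
    change @IsClosed _ (weakStarTopology R.space) {T | ∃ A ∈ 𝕍.V t, R.compress A = T}
    rw [h]
    exact @IsClosed.preimage _ _ (weakStarTopology R.space) (weakStarTopology H) _
      R.continuous_inflate _ (𝕍.isClosed_V t)
  V_zero := by
    ext T
    change (∃ A ∈ 𝕍.V 0, R.compress A = T) ↔ T ∈ R.algebra.commutant
    rw [𝕍.exists_compress_mem_V_iff, R.mem_algebra_commutant, ← SetLike.mem_coe, 𝕍.V_zero,
      SetLike.mem_coe]
  star_mem_V t T hT := by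
    refine (𝕍.exists_compress_mem_V_iff R).2 ?_
    rw [R.inflate_star]
    exact 𝕍.star_mem_V t _ ((𝕍.exists_compress_mem_V_iff R).1 hT)
  mul_mem_V s t S hS T hT := by
    refine (𝕍.exists_compress_mem_V_iff R).2 ?_
    rw [R.inflate_mul]
    exact 𝕍.mul_mem_V s t _ ((𝕍.exists_compress_mem_V_iff R).1 hS) _
      ((𝕍.exists_compress_mem_V_iff R).1 hT)
  V_eq_iInf t := by
    ext T
    simp only [Submodule.mem_iInf, Submodule.mem_mk, AddSubmonoid.mem_mk,
      AddSubsemigroup.mem_mk, Set.mem_ofPred_eq, 𝕍.exists_compress_mem_V_iff]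
    rw [𝕍.V_eq_iInf t]
    simp only [Submodule.mem_iInf]

end QuantumMetric

end Main

end QMetric

end

namespace QMetric

open InnerProductSpace (rankOne)

/-! ### Projections, their joins, and membership in a von Neumann algebra. -/

section Projections

variable {H : Type*} [NormedAddCommGroup H] [InnerProductSpace ℂ H] [CompleteSpace H]

/-! This is the quantum form of the finite union theorem for asymptotic dimension: covers of the two
pieces are merged, index by index, by saturated unions.

Given `r`, take families on the range of `R₁` that are separated at scale `2r`, with diameter bound
`a`. Only then take families on the range of `R₂`, separated at scale `2r + a + 2r`, with some
diameter bound `c`. Each member of the second family absorbs the members of the first that are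
`2r`-close to it, and the remaining members of the first are kept. A member of diameter at most `a`
cannot be `2r`-close to two distinct members of the second family, so the result is `2r`-separated
(`saturatedUnion_separated`). Its diameters are at most `a + 2r + c + 2r + a`
(`saturatedUnion_bounded`), and nothing covered is lost.

Reflexivity allows points to be replaced by vectors: membership in `𝒱_t` is tested on pairs of
vectors (`operatorReflexive_iff`). Hence `diam P ≤ d` means `P B(H) P ⊆ 𝒱_d` (`diam_le_iff`), which
removes the amplification, and the triangle inequality becomes a product with rank-one operators
inserted (`mul_mul_mem_V_chain`, `exists_mul_mul_ne_zero`).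

Disjointness of neighborhoods is exchanged for separation `P 𝒱_t Q = 0`: `r`-disjointness gives it
for `t < r`, and `t = 2r` gives `r`-disjointness back. Centrality of `R₁` and `R₂` allows the
families on the quotients to be extended by zero to families in `M`. -/

theorem inner_isSelfAdjoint {P : H →L[ℂ] H} (hP : IsStarProjection P) (x y : H) :
    inner ℂ (P x) y = inner ℂ x (P y) :=
  ContinuousLinearMap.isSelfAdjoint_iff_isSymmetric.1 hP.isSelfAdjoint x y

theorem inner_star_apply (A : H →L[ℂ] H) (x y : H) :
    inner ℂ (star A x) y = inner ℂ x (A y) := by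
  rw [ContinuousLinearMap.star_eq_adjoint, ContinuousLinearMap.adjoint_inner_left]

theorem apply_apply_of_isStarProjection {P : H →L[ℂ] H} (hP : IsStarProjection P) (x : H) :
    P (P x) = P x :=
  DFunLike.congr_fun hP.isIdempotentElem x

omit [CompleteSpace H] in
theorem eq_zero_of_forall_inner {A : H →L[ℂ] H} (h : ∀ x y, inner ℂ x (A y) = 0) : A = 0 := by
  ext y
  exact inner_self_eq_zero.1 (h (A y) y)

omit [CompleteSpace H] in
theorem exists_inner_ne_zero {A : H →L[ℂ] H} (h : A ≠ 0) : ∃ x y, inner ℂ x (A y) ≠ 0 := by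
  by_contra! h'
  exact h (eq_zero_of_forall_inner h')

theorem mul_mul_eq_zero_iff_star {P Q A : H →L[ℂ] H} (hP : IsStarProjection P)
    (hQ : IsStarProjection Q) : P * A * Q = 0 ↔ Q * star A * P = 0 := by
  rw [← star_eq_zero, star_mul, star_mul, hP.isSelfAdjoint.star_eq, hQ.isSelfAdjoint.star_eq,
    mul_assoc]

theorem isStarProjection_projSup (S : Set (H →L[ℂ] H)) : IsStarProjection (projSup S) :=
  isStarProjection_starProjection

theorem projSup_apply_eq_self_iff {S : Set (H →L[ℂ] H)} {x : H} :
    projSup S x = x ↔ x ∈ (⨆ P ∈ S, P.range).topologicalClosure :=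
  Submodule.starProjection_eq_self_iff

theorem projSup_apply_of_mem {S : Set (H →L[ℂ] H)} {P : H →L[ℂ] H} (hP : P ∈ S) (x : H) :
    projSup S (P x) = P x :=
  projSup_apply_eq_self_iff.2 <| Submodule.le_topologicalClosure _ <|
    Submodule.mem_iSup_of_mem P <| Submodule.mem_iSup_of_mem hP ⟨x, rfl⟩

theorem projSup_apply_eq_zero {S : Set (H →L[ℂ] H)} (hS : ∀ P ∈ S, IsStarProjection P) {x : H}
    (h : ∀ P ∈ S, P x = 0) : projSup S x = 0 := by
  refine (Submodule.starProjection_apply_eq_zero_iff _).2 ?_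
  have hle : (⨆ P ∈ S, P.range).topologicalClosure ≤ (ℂ ∙ x)ᗮ := by
    refine Submodule.topologicalClosure_minimal _ (iSup₂_le fun P hP => ?_)
      (Submodule.isClosed_orthogonal _)
    rintro _ ⟨v, rfl⟩
    refine Submodule.mem_orthogonal_singleton_iff_inner_left.2 ?_
    change inner ℂ (P v) x = 0
    rw [inner_isSelfAdjoint (hS P hP), h P hP, inner_zero_right]
  exact fun u hu => Submodule.mem_orthogonal_singleton_iff_inner_left.1 (hle hu)

/-- A join kills every vector killed by all its members. This handles the left factor, and passing
to adjoints turns the right factor into a left one. -/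
theorem projSup_mul_mul_projSup_eq_zero {S T : Set (H →L[ℂ] H)}
    (hS : ∀ P ∈ S, IsStarProjection P) (hT : ∀ P ∈ T, IsStarProjection P) {A : H →L[ℂ] H}
    (h : ∀ P ∈ S, ∀ Q ∈ T, P * A * Q = 0) : projSup S * A * projSup T = 0 := by
  rw [mul_mul_eq_zero_iff_star (isStarProjection_projSup S) (isStarProjection_projSup T)]
  ext x
  refine projSup_apply_eq_zero hT fun Q hQ => ?_
  suffices h' : Q * star A * projSup S = 0 from DFunLike.congr_fun h' x
  rw [← mul_mul_eq_zero_iff_star (isStarProjection_projSup S) (hT Q hQ)]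
  ext y
  exact projSup_apply_eq_zero hS fun P hP => DFunLike.congr_fun (h P hP Q hQ) y

theorem projSup_apply_eq_self_of_forall {S T : Set (H →L[ℂ] H)}
    (h : ∀ P ∈ S, ∀ x, projSup T (P x) = P x) {x : H} (hx : projSup S x = x) :
    projSup T x = x := by
  rw [projSup_apply_eq_self_iff] at hx ⊢
  refine Submodule.topologicalClosure_minimal _ (iSup₂_le fun P hP => ?_)
    (Submodule.isClosed_topologicalClosure _) hx
  rintro _ ⟨y, rfl⟩
  exact projSup_apply_eq_self_iff.1 (h P hP y)

/-- A projection lies in `M = M''` as soon as its range is invariant under `M'`. -/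
theorem starProjection_mem {M : VonNeumannAlgebra H} (K : Submodule ℂ H)
    [K.HasOrthogonalProjection] (hK : ∀ C ∈ M.commutant, ∀ x ∈ K, C x ∈ K) :
    K.starProjection ∈ projections M := by
  refine ⟨(VonNeumannAlgebra.IsStarProjection.mem_iff isStarProjection_starProjection M).2
    fun C hC => ?_, isStarProjection_starProjection⟩
  rw [Submodule.range_starProjection]
  exact fun x hx => hK C hC x hx

theorem projSup_mem_projections {M : VonNeumannAlgebra H} {S : Set (H →L[ℂ] H)}
    (hS : S ⊆ projections M) : projSup S ∈ projections M := by
  refine starProjection_mem _ fun C hC x hx => ?_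
  have h : (⨆ P ∈ S, P.range).topologicalClosure ≤
      (⨆ P ∈ S, P.range).topologicalClosure.comap (C : H →ₗ[ℂ] H) := by
    refine Submodule.topologicalClosure_minimal _ (iSup₂_le fun P hP => ?_)
      ((Submodule.isClosed_topologicalClosure _).preimage C.continuous)
    rintro _ ⟨y, rfl⟩
    have h1 : C (P y) = P (C y) :=
      (DFunLike.congr_fun (VonNeumannAlgebra.mem_commutant_iff.1 hC P (hS hP).1) y).symm
    change C (P y) ∈ (⨆ P ∈ S, P.range).topologicalClosure
    rw [h1]
    exact projSup_apply_eq_self_iff.1 (projSup_apply_of_mem hP _)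
  exact h hx

theorem isStarProjection_tensor_one {P : H →L[ℂ] H} (hP : IsStarProjection P) :
    IsStarProjection (tensor P 1) := by
  refine ⟨?_, ContinuousLinearMap.isSelfAdjoint_iff_isSymmetric.2 fun x y => ?_⟩
  · change tensor P 1 * tensor P 1 = tensor P 1
    rw [← tensor_one_mul, hP.isIdempotentElem.eq]
  · change inner ℂ (tensor P 1 x) y = inner ℂ x (tensor P 1 y)
    induction x, y using UniformSpace.Completion.induction_on₂ with
    | hp =>
      exact isClosed_eq
        (((tensor P 1).continuous.comp continuous_fst).inner continuous_snd)
        (continuous_fst.inner ((tensor P 1).continuous.comp continuous_snd))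
    | ih a b =>
      simp only [tensor, ContinuousLinearMap.completion_apply_coe,
        UniformSpace.Completion.inner_coe]
      induction a using TensorProduct.induction_on with
      | zero => simp
      | add a a' ha ha' => simp only [map_add, inner_add_left, ha, ha']
      | tmul u v =>
        induction b using TensorProduct.induction_on with
        | zero => simp
        | add b b' hb hb' => simp only [map_add, inner_add_right, hb, hb']
        | tmul u' v' =>
          rw [TensorProduct.mapL_tmul, TensorProduct.mapL_tmul, TensorProduct.inner_tmul,
            TensorProduct.inner_tmul, inner_isSelfAdjoint hP]
          rfl

/-- Makes projections of `M` available as test projections in the definition of `diam`. -/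
theorem tensor_one_mem_ampProjections {M : VonNeumannAlgebra H} {P : H →L[ℂ] H}
    (hP : P ∈ projections M) : tensor P 1 ∈ ampProjections M :=
  ⟨@subset_closure _ (weakStarTopology (HilbertTensor H)) _ _
    (Submodule.subset_span ⟨P, hP.1, 1, rfl⟩), isStarProjection_tensor_one hP.2⟩

/-! ### Reflexivity tested on vectors, and cyclic projections. -/

/-- Rank-one projections onto the lines `ℂ x` and `ℂ y` already detect everything that pairs of
projections do: compressing `A` by them retains only the scalar `⟪x, A y⟫`. -/
theorem operatorReflexive_iff {W : Submodule ℂ (H →L[ℂ] H)} :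
    OperatorReflexive W ↔
      ∀ B : H →L[ℂ] H, (∀ x y, (∀ A ∈ W, inner ℂ x (A y) = 0) → inner ℂ x (B y) = 0) → B ∈ W := by
  constructor
  · intro h B hB
    rw [← SetLike.mem_coe, h]
    intro P Q hP hQ hPQ
    refine eq_zero_of_forall_inner fun x y => ?_
    have h1 : ∀ A : H →L[ℂ] H, inner ℂ x ((P * A * Q) y) = inner ℂ (P x) (A (Q y)) :=
      fun A => (inner_isSelfAdjoint hP x (A (Q y))).symm
    rw [h1]
    refine hB _ _ fun A hA => ?_
    rw [← h1, hPQ A hA]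
    simp
  · intro h
    refine Set.Subset.antisymm (fun B hB P Q _ _ hPQ => hPQ B hB) fun B hB => h B fun x y hxy => ?_
    have h1 : ∀ A : H →L[ℂ] H,
        inner ℂ x (((ℂ ∙ x).starProjection * A * (ℂ ∙ y).starProjection) y)
          = inner ℂ x (A y) := by
      intro A
      change inner ℂ x ((ℂ ∙ x).starProjection (A ((ℂ ∙ y).starProjection y))) = _
      rw [← Submodule.inner_starProjection_left_eq_right,
        Submodule.starProjection_eq_self_iff.2 (Submodule.mem_span_singleton_self x),
        Submodule.starProjection_eq_self_iff.2 (Submodule.mem_span_singleton_self y)]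
    rw [← h1, hB _ _ isStarProjection_starProjection isStarProjection_starProjection]
    · simp
    · intro A hA
      refine eq_zero_of_forall_inner fun u v => ?_
      change inner ℂ u ((ℂ ∙ x).starProjection (A ((ℂ ∙ y).starProjection v))) = _
      rw [← Submodule.inner_starProjection_left_eq_right]
      obtain ⟨c, hc⟩ := Submodule.mem_span_singleton.1 ((ℂ ∙ x).starProjection_apply_mem u)
      obtain ⟨d, hd⟩ := Submodule.mem_span_singleton.1 ((ℂ ∙ y).starProjection_apply_mem v)
      rw [← hc, ← hd, map_smul, inner_smul_left, inner_smul_right, hxy A hA]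
      simp

/-- The closure of `M' x`, the smallest closed subspace that contains `x` and is invariant
under `M'`. -/
noncomputable def cyclicSubspace (M : VonNeumannAlgebra H) (x : H) : Submodule ℂ H :=
  (M.commutant.toStarSubalgebra.toSubalgebra.toSubmodule.map
    (ContinuousLinearMap.apply ℂ H x : (H →L[ℂ] H) →ₗ[ℂ] H)).topologicalClosure

variable {M : VonNeumannAlgebra H}

theorem apply_mem_cyclicSubspace {C : H →L[ℂ] H} (hC : C ∈ M.commutant) (x : H) :
    C x ∈ cyclicSubspace M x :=
  Submodule.le_topologicalClosure _ ⟨C, hC, rfl⟩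

theorem cyclicSubspace_le {x : H} {K : Submodule ℂ H} (hK : IsClosed (K : Set H))
    (h : ∀ C ∈ M.commutant, C x ∈ K) : cyclicSubspace M x ≤ K := by
  refine Submodule.topologicalClosure_minimal _ ?_ hK
  rintro _ ⟨C, hC, rfl⟩
  exact h C hC

instance (x : H) : CompleteSpace (cyclicSubspace M x) :=
  (Submodule.isClosed_topologicalClosure _).completeSpace_coe

theorem starProjection_cyclicSubspace_mem (x : H) :
    (cyclicSubspace M x).starProjection ∈ projections M := by
  refine starProjection_mem _ fun C hC y hy => ?_
  have h : cyclicSubspace M x ≤ (cyclicSubspace M x).comap (C : H →ₗ[ℂ] H) :=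
    cyclicSubspace_le ((Submodule.isClosed_topologicalClosure _).preimage C.continuous)
      fun D hD => apply_mem_cyclicSubspace (mul_mem hC hD) x
  exact h hy

end Projections

/-! ### The `M'`-bimodules `𝒱_t` and the diameter. -/

namespace QuantumMetric

variable {H : Type*} [NormedAddCommGroup H] [InnerProductSpace ℂ H] [CompleteSpace H]
  {M : VonNeumannAlgebra H} (𝕍 : QuantumMetric M)

theorem V_mono {s t : ℝ≥0} (h : s ≤ t) : 𝕍.V s ≤ 𝕍.V t := by
  rcases eq_or_lt_of_le h with rfl | h
  · exact le_rfl
  · rw [𝕍.V_eq_iInf s]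
    exact iInf₂_le t h

theorem commutant_le_V_zero {C : H →L[ℂ] H} (hC : C ∈ M.commutant) : C ∈ 𝕍.V 0 := by
  rw [← SetLike.mem_coe, 𝕍.V_zero]
  exact hC

theorem one_mem_V (t : ℝ≥0) : (1 : H →L[ℂ] H) ∈ 𝕍.V t :=
  𝕍.V_mono zero_le (𝕍.commutant_le_V_zero (one_mem _))

theorem commutant_mul_mem_V {t : ℝ≥0} {C A : H →L[ℂ] H} (hC : C ∈ M.commutant)
    (hA : A ∈ 𝕍.V t) : C * A ∈ 𝕍.V t := by
  simpa using 𝕍.mul_mem_V 0 t C (𝕍.commutant_le_V_zero hC) A hA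

theorem mul_commutant_mem_V {t : ℝ≥0} {C A : H →L[ℂ] H} (hC : C ∈ M.commutant)
    (hA : A ∈ 𝕍.V t) : A * C ∈ 𝕍.V t := by
  simpa using 𝕍.mul_mem_V t 0 A hA C (𝕍.commutant_le_V_zero hC)

/-- Reflexivity separates `B` from `𝒱_t` by vectors `x`, `y`. Since `𝒱_t` is an `M'`-bimodule, the
vanishing of `⟪x, A y⟫` spreads to the closures of `M' x` and `M' y`, whose projections lie in `M`.
-/
theorem exists_separating_projections (h𝕍 : 𝕍.IsReflexive) {t : ℝ≥0} {B : H →L[ℂ] H}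
    (hB : B ∉ 𝕍.V t) : ∃ P ∈ projections M, ∃ Q ∈ projections M,
      P * B * Q ≠ 0 ∧ ∀ A ∈ 𝕍.V t, P * A * Q = 0 := by
  have h : ∃ x y, (∀ A ∈ 𝕍.V t, inner ℂ x (A y) = 0) ∧ inner ℂ x (B y) ≠ 0 := by
    by_contra! h
    exact hB (operatorReflexive_iff.1 (h𝕍 t) B h)
  obtain ⟨x, y, hA, hxy⟩ := h
  refine ⟨_, starProjection_cyclicSubspace_mem x, _, starProjection_cyclicSubspace_mem y,
    fun h => hxy ?_, fun A hA' => eq_zero_of_forall_inner fun u v => ?_⟩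
  · have hx : x ∈ cyclicSubspace M x := apply_mem_cyclicSubspace (one_mem M.commutant) x
    have hy : y ∈ cyclicSubspace M y := apply_mem_cyclicSubspace (one_mem M.commutant) y
    have h1 := congrArg (inner ℂ x) (DFunLike.congr_fun h y)
    change inner ℂ x (Submodule.starProjection _ (B (Submodule.starProjection _ y))) = _ at h1
    rw [← Submodule.inner_starProjection_left_eq_right, Submodule.starProjection_eq_self_iff.2 hx,
      Submodule.starProjection_eq_self_iff.2 hy] at h1
    simpa using h1
  · change inner ℂ u (Submodule.starProjection _ (A (Submodule.starProjection _ v))) = _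
    rw [← Submodule.inner_starProjection_left_eq_right]
    have h1 : ∀ w ∈ cyclicSubspace M y, ∀ C ∈ M.commutant, inner ℂ (C x) (A w) = 0 := by
      intro w hw C hC
      have h2 : cyclicSubspace M y ≤ (ℂ ∙ (star A (C x)))ᗮ := by
        refine cyclicSubspace_le (Submodule.isClosed_orthogonal _) fun D hD => ?_
        rw [Submodule.mem_orthogonal_singleton_iff_inner_right, inner_star_apply,
          ← star_star C, inner_star_apply]
        exact hA _ (𝕍.commutant_mul_mem_V (star_mem hC) (𝕍.mul_commutant_mem_V hD hA'))
      rw [← inner_star_apply]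
      exact Submodule.mem_orthogonal_singleton_iff_inner_right.1 (h2 hw)
    have h3 : cyclicSubspace M x ≤ (ℂ ∙ (A ((cyclicSubspace M y).starProjection v)))ᗮ :=
      cyclicSubspace_le (Submodule.isClosed_orthogonal _) fun C hC =>
        Submodule.mem_orthogonal_singleton_iff_inner_left.2
          (h1 _ (Submodule.starProjection_apply_mem _ _) C hC)
    exact Submodule.mem_orthogonal_singleton_iff_inner_left.1
      (h3 (Submodule.starProjection_apply_mem _ _))

/-- Forward, if `P A P` lay outside `𝒱_s` with `s > d`, separating projections of `M` would be at
distance at least `s` while `P A P` connects them. Backward, `P A P` itself witnesses the bound on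
the distance. -/
theorem diam_le_iff (h𝕍 : 𝕍.IsReflexive) {P : H →L[ℂ] H} {d : ℝ≥0} :
    𝕍.diam P ≤ d ↔ ∀ A, P * A * P ∈ 𝕍.V d := by
  constructor
  · intro h A
    -- Right continuity of the filtration provides the strict inequality `d < s` needed for the
    -- contradiction.
    rw [𝕍.V_eq_iInf d]
    simp only [Submodule.mem_iInf]
    intro s hs
    by_contra hA
    obtain ⟨Q, hQ, R, hR, hne, hzero⟩ := 𝕍.exists_separating_projections h𝕍 hA
    have h1 : 𝕍.dist Q R ≤ d := by
      refine le_trans (le_sSup ?_) h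
      refine ⟨_, tensor_one_mem_ampProjections hQ, _, tensor_one_mem_ampProjections hR,
        ⟨A, ?_⟩, (𝕍.ampDist_tensor_one Q R).symm⟩
      rw [← tensor_one_mul, ← tensor_one_mul]
      exact tensor_one_eq_zero.not.2 hne
    have h2 : (s : ℝ≥0∞) ≤ 𝕍.dist Q R := by
      refine le_iInf₂ fun t ht => ?_
      obtain ⟨B, hB, hne⟩ := ht
      by_contra! hts
      exact hne (hzero B (𝕍.V_mono (by exact_mod_cast hts.le) hB))
    exact absurd (h2.trans h1) (not_le.2 (by exact_mod_cast hs))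
  · rintro h
    refine sSup_le ?_
    rintro _ ⟨Q, -, R, -, ⟨A, hA⟩, rfl⟩
    exact iInf₂_le d ⟨_, h A, hA⟩

/-! ### Distance, open neighborhoods and separation. -/

theorem le_dist_iff {P Q : H →L[ℂ] H} {r : ℝ≥0} :
    (r : ℝ≥0∞) ≤ 𝕍.dist P Q ↔ ∀ t < r, ∀ A ∈ 𝕍.V t, P * A * Q = 0 := by
  constructor
  · intro h t ht A hA
    by_contra hne
    exact absurd (h.trans (iInf₂_le t ⟨A, hA, hne⟩)) (not_le.2 (by exact_mod_cast ht))
  · intro h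
    refine le_iInf₂ fun t ⟨A, hA, hne⟩ => ?_
    by_contra! ht
    exact hne (h t (by exact_mod_cast ht) A hA)

/-- Every projection of `M` at distance at least `r` from `P` annihilates `𝒱_t P H` when `t < r`, so
these vectors lie in the range of the neighborhood. -/
theorem nhd_apply_of_mem_V {P : H →L[ℂ] H} (hP : IsStarProjection P) {r t : ℝ≥0} (ht : t < r)
    {A : H →L[ℂ] H} (hA : A ∈ 𝕍.V t) (x : H) : 𝕍.nhd P r (A (P x)) = A (P x) := by
  have h : projSup {Q | Q ∈ projections M ∧ (r : ℝ≥0∞) ≤ 𝕍.dist P Q} (A (P x)) = 0 := by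
    refine projSup_apply_eq_zero (fun Q hQ => hQ.1.2) fun Q hQ => ?_
    have h1 := 𝕍.le_dist_iff.1 hQ.2 t ht _ (𝕍.star_mem_V t A hA)
    rw [mul_mul_eq_zero_iff_star hP hQ.1.2, star_star] at h1
    exact DFunLike.congr_fun h1 x
  simp [nhd, h]

theorem isStarProjection_nhd (P : H →L[ℂ] H) (r : ℝ≥0) : IsStarProjection (𝕍.nhd P r) :=
  (isStarProjection_projSup _).one_sub

/-- The range of `P` lies in `(P)_r` and that of `A Q` lies in `(Q)_r`, and these neighborhoods are
orthogonal. -/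
theorem mul_mul_eq_zero_of_nhd_mul_nhd {P Q : H →L[ℂ] H} (hP : IsStarProjection P)
    (hQ : IsStarProjection Q) {r t : ℝ≥0} (h : 𝕍.nhd P r * 𝕍.nhd Q r = 0) (ht : t < r)
    {A : H →L[ℂ] H} (hA : A ∈ 𝕍.V t) : P * A * Q = 0 := by
  refine eq_zero_of_forall_inner fun x y => ?_
  change inner ℂ x (P (A (Q y))) = 0
  have h1 := 𝕍.nhd_apply_of_mem_V hP ht (𝕍.one_mem_V t) x
  change 𝕍.nhd P r (P x) = P x at h1
  rw [← inner_isSelfAdjoint hP, ← h1, ← 𝕍.nhd_apply_of_mem_V hQ ht hA,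
    inner_isSelfAdjoint (𝕍.isStarProjection_nhd P r)]
  have h2 := DFunLike.congr_fun h (A (Q y))
  change 𝕍.nhd P r (𝕍.nhd Q r (A (Q y))) = 0 at h2
  rw [h2, inner_zero_right]

/-- The vectors orthogonal to `𝒱_t P` for all `t < r`. -/
noncomputable def farSubspace (P : H →L[ℂ] H) (r : ℝ≥0) : Submodule ℂ H :=
  (Submodule.span ℂ {x | ∃ t < r, ∃ A ∈ 𝕍.V t, ∃ y, A (P y) = x})ᗮ

theorem mem_farSubspace {P : H →L[ℂ] H} {r : ℝ≥0} {z : H} :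
    z ∈ 𝕍.farSubspace P r ↔ ∀ t < r, ∀ A ∈ 𝕍.V t, ∀ y, inner ℂ (A (P y)) z = 0 := by
  constructor
  · intro h t ht A hA y
    exact h _ (Submodule.subset_span ⟨t, ht, A, hA, y, rfl⟩)
  · intro h
    have hle : Submodule.span ℂ {x | ∃ t < r, ∃ A ∈ 𝕍.V t, ∃ y, A (P y) = x} ≤ (ℂ ∙ z)ᗮ := by
      refine Submodule.span_le.2 ?_
      rintro _ ⟨t, ht, A, hA, y, rfl⟩
      exact Submodule.mem_orthogonal_singleton_iff_inner_left.2 (h t ht A hA y)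
    exact fun u hu => Submodule.mem_orthogonal_singleton_iff_inner_left.1 (hle hu)

instance (P : H →L[ℂ] H) (r : ℝ≥0) : CompleteSpace (𝕍.farSubspace P r) :=
  (Submodule.isClosed_orthogonal _).completeSpace_coe

/-- The far subspace is `M'`-invariant, so its projection is one of those removed in forming
`(P)_r`. Thus `(P)_r` is no larger than the closed span of the `𝒱_t P H` with `t < r`. -/
theorem inner_nhd_of_mem_farSubspace {P : H →L[ℂ] H} (hP : IsStarProjection P) {r : ℝ≥0} {z : H}
    (hz : z ∈ 𝕍.farSubspace P r) (x : H) : inner ℂ z (𝕍.nhd P r x) = 0 := by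
  have hS : (𝕍.farSubspace P r).starProjection ∈
      {Q | Q ∈ projections M ∧ (r : ℝ≥0∞) ≤ 𝕍.dist P Q} := by
    refine ⟨starProjection_mem _ fun C hC y hy => ?_, 𝕍.le_dist_iff.2 fun t ht A hA => ?_⟩
    · rw [mem_farSubspace] at hy ⊢
      intro t ht A hA w
      rw [← inner_star_apply]
      exact hy t ht _ (𝕍.commutant_mul_mem_V (star_mem hC) hA) w
    · refine eq_zero_of_forall_inner fun u v => ?_
      have h := 𝕍.mem_farSubspace.1 ((𝕍.farSubspace P r).starProjection_apply_mem v) t ht _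
        (𝕍.star_mem_V t A hA) u
      rw [inner_star_apply, inner_isSelfAdjoint hP] at h
      exact h
  have h1 := projSup_apply_of_mem hS z
  rw [Submodule.starProjection_eq_self_iff.2 hz] at h1
  have h2 : 𝕍.nhd P r z = 0 := by
    simp [nhd, h1]
  rw [← inner_isSelfAdjoint (𝕍.isStarProjection_nhd P r), h2, inner_zero_left]

/-- The neighborhoods are spanned by vectors `A P u` and `B Q v` with `A`, `B` of displacement below
`r`, and `⟪A P u, B Q v⟫` is a coefficient of `P A* B Q` with `A* B` in `𝒱_{2r}`. -/
theorem nhd_mul_nhd_eq_zero {P Q : H →L[ℂ] H} (hP : IsStarProjection P)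
    (hQ : IsStarProjection Q) {r : ℝ≥0} (h : ∀ A ∈ 𝕍.V (r + r), P * A * Q = 0) :
    𝕍.nhd P r * 𝕍.nhd Q r = 0 := by
  refine eq_zero_of_forall_inner fun x y => ?_
  change inner ℂ x (𝕍.nhd P r (𝕍.nhd Q r y)) = 0
  rw [← inner_isSelfAdjoint (𝕍.isStarProjection_nhd P r)]
  refine 𝕍.inner_nhd_of_mem_farSubspace hQ (𝕍.mem_farSubspace.2 fun t ht B hB v => ?_) y
  refine 𝕍.inner_nhd_of_mem_farSubspace hP (𝕍.mem_farSubspace.2 fun s hs A hA u => ?_) x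
  have hAB : star A * B ∈ 𝕍.V (r + r) :=
    𝕍.V_mono (add_le_add hs.le ht.le) (𝕍.mul_mem_V s t _ (𝕍.star_mem_V s A hA) B hB)
  have h1 := congrArg (inner ℂ u) (DFunLike.congr_fun (h _ hAB) v)
  change inner ℂ u (P (star A (B (Q v)))) = inner ℂ u 0 at h1
  rw [← inner_isSelfAdjoint hP, ← inner_star_apply, star_star, inner_zero_right] at h1
  exact h1

/-! ### Triangle inequalities through rank-one operators. -/

theorem mul_mul_mem_V_of_forall (h𝕍 : 𝕍.IsReflexive) {P Q : H →L[ℂ] H}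
    (hP : IsStarProjection P) {t : ℝ≥0}
    (h : ∀ z w, (∀ B ∈ 𝕍.V t, inner ℂ z (B w) = 0) → P z = 0 ∨ Q w = 0) (A : H →L[ℂ] H) :
    P * A * Q ∈ 𝕍.V t := by
  refine operatorReflexive_iff.1 (h𝕍 t) _ fun z w hzw => ?_
  change inner ℂ z (P (A (Q w))) = 0
  rw [← inner_isSelfAdjoint hP]
  rcases h z w hzw with h | h <;> simp [h]

theorem inner_self_apply_ne_zero {P : H →L[ℂ] H} (hP : IsStarProjection P) {z : H}
    (hz : P z ≠ 0) : inner ℂ z (P z) ≠ 0 := by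
  rw [← apply_apply_of_isStarProjection hP, ← inner_isSelfAdjoint hP]
  exact inner_self_ne_zero.2 hz

/-- Two bounded sets joined by a step of length `b` have a union of diameter at most `a + b + c`. If
`z`, `w` annihilate `𝒱_{a+b+c}`, they annihilate a product running along the chain, and this forces
`P z = 0` or `Q' w = 0`. -/
theorem mul_mul_mem_V_chain (h𝕍 : 𝕍.IsReflexive) {P P' Q Q' B : H →L[ℂ] H}
    (hP : IsStarProjection P) (hQ' : IsStarProjection Q') {a b c : ℝ≥0}
    (hPP' : ∀ A, P * A * P' ∈ 𝕍.V a) (hB : B ∈ 𝕍.V b) (hne : P' * B * Q ≠ 0)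
    (hQQ' : ∀ A, Q * A * Q' ∈ 𝕍.V c) (A : H →L[ℂ] H) : P * A * Q' ∈ 𝕍.V (a + b + c) := by
  refine 𝕍.mul_mul_mem_V_of_forall h𝕍 hP (fun z w h => ?_) A
  by_contra! hzw
  obtain ⟨u, v, huv⟩ := exists_inner_ne_zero hne
  -- The coefficient of this product at `z`, `w` factors as `⟪z, P z⟫ ⟪u, P' B Q v⟫ ⟪w, Q' w⟫`.
  have h1 := h _ (𝕍.mul_mem_V _ _ _ (𝕍.mul_mem_V _ _ _ (hPP' (rankOne ℂ z u)) _ hB) _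
    (hQQ' (rankOne ℂ v w)))
  simp only [mul_apply_eq_comp, InnerProductSpace.rankOne_apply, map_smul,
    inner_smul_right, mul_eq_zero] at h1
  rcases h1 with h1 | h1 | h1
  · exact inner_self_apply_ne_zero hQ' hzw.2 h1
  · exact huv h1
  · exact inner_self_apply_ne_zero hP hzw.1 h1

/-- If `P` and `R` are both close to a `Q` of small diameter, they are close to each other: the
rank-one operator carrying `u'` to a multiple of `v`, compressed by `Q`, bridges the two nonzero
coefficients. -/
theorem exists_mul_mul_ne_zero {P Q R A B : H →L[ℂ] H} {a b c : ℝ≥0} (hA : A ∈ 𝕍.V a)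
    (hB : B ∈ 𝕍.V c) (hQ : ∀ X, Q * X * Q ∈ 𝕍.V b) (hPQ : P * A * Q ≠ 0) (hQR : Q * B * R ≠ 0) :
    ∃ C ∈ 𝕍.V (a + b + c), P * C * R ≠ 0 := by
  obtain ⟨u, v, huv⟩ := exists_inner_ne_zero hPQ
  obtain ⟨u', v', huv'⟩ := exists_inner_ne_zero hQR
  refine ⟨_, 𝕍.mul_mem_V _ _ _ (𝕍.mul_mem_V _ _ _ hA _ (hQ (rankOne ℂ v u'))) _ hB, fun h => ?_⟩
  have h1 := congrArg (inner ℂ u) (DFunLike.congr_fun h v')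
  simp only [mul_apply_eq_comp, InnerProductSpace.rankOne_apply, map_smul,
    inner_smul_right, zero_apply, inner_zero_right, mul_eq_zero] at h1
  exact h1.elim huv' huv

/-- A vector not killed by the join is not killed by some member, so a mutual bound between members
already controls the join. -/
theorem projSup_mul_mul_projSup_mem_V (h𝕍 : 𝕍.IsReflexive) {S : Set (H →L[ℂ] H)}
    (hS : ∀ P ∈ S, IsStarProjection P) {t : ℝ≥0}
    (h : ∀ P ∈ S, ∀ Q ∈ S, ∀ A, P * A * Q ∈ 𝕍.V t) (A : H →L[ℂ] H) :
    projSup S * A * projSup S ∈ 𝕍.V t := by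
  refine 𝕍.mul_mul_mem_V_of_forall h𝕍 (isStarProjection_projSup S) (fun z w hzw => ?_) A
  by_contra! hne
  have h1 : ∀ x, projSup S x ≠ 0 → ∃ P ∈ S, P x ≠ 0 := fun x hx => by
    by_contra! hx'
    exact hx (projSup_apply_eq_zero hS hx')
  obtain ⟨P, hP, hPz⟩ := h1 z hne.1
  obtain ⟨Q, hQ, hQw⟩ := h1 w hne.2
  have h2 := hzw _ (h P hP Q hQ (rankOne ℂ z w))
  simp only [mul_apply_eq_comp, InnerProductSpace.rankOne_apply, map_smul,
    inner_smul_right, mul_eq_zero] at h2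
  exact h2.elim (inner_self_apply_ne_zero (hS Q hQ) hQw) (inner_self_apply_ne_zero (hS P hP) hPz)

/-! ### Saturated unions: covering, boundedness and separation. -/

theorem forall_mul_mul_eq_zero_symm {P Q : H →L[ℂ] H} (hP : IsStarProjection P)
    (hQ : IsStarProjection Q) {t : ℝ≥0} (h : ∀ A ∈ 𝕍.V t, P * A * Q = 0) :
    ∀ A ∈ 𝕍.V t, Q * A * P = 0 := fun A hA =>
  (mul_mul_eq_zero_iff_star hQ hP).2 (h _ (𝕍.star_mem_V t A hA))

/-- The join of `Q` with the members of `𝒰` at distance at most `r` from it. -/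
noncomputable def absorb (𝒰 : Set (H →L[ℂ] H)) (r : ℝ≥0) (Q : H →L[ℂ] H) : H →L[ℂ] H :=
  projSup (insert Q {P | P ∈ 𝒰 ∧ ∃ A ∈ 𝕍.V r, P * A * Q ≠ 0})

/-- The `r`-saturated union of two families. -/
def saturatedUnion (𝒰 𝒲 : Set (H →L[ℂ] H)) (r : ℝ≥0) : Set (H →L[ℂ] H) :=
  𝕍.absorb 𝒰 r '' 𝒲 ∪ {P | P ∈ 𝒰 ∧ ∀ Q ∈ 𝒲, ∀ A ∈ 𝕍.V r, P * A * Q = 0}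

section SaturatedUnion

variable {𝒰 𝒲 : Set (H →L[ℂ] H)} (h𝒰 : 𝒰 ⊆ projections M) (h𝒲 : 𝒲 ⊆ projections M)
  {r a c : ℝ≥0}

theorem projSup_apply_of_saturatedUnion_subset {F : Set (H →L[ℂ] H)}
    (hF : 𝕍.saturatedUnion 𝒰 𝒲 r ⊆ F) {P : H →L[ℂ] H} (hP : P ∈ 𝒰 ∪ 𝒲) (x : H) :
    projSup F (P x) = P x := by
  have habs : ∀ Q ∈ 𝒲, ∀ P ∈ insert Q {P | P ∈ 𝒰 ∧ ∃ A ∈ 𝕍.V r, P * A * Q ≠ 0},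
      projSup F (P x) = P x := by
    intro Q hQ P hP
    have h1 : 𝕍.absorb 𝒰 r Q (P x) = P x := projSup_apply_of_mem hP x
    have h2 := projSup_apply_of_mem (hF (Or.inl ⟨Q, hQ, rfl⟩)) (P x)
    rwa [h1] at h2
  rcases hP with hP | hP
  · by_cases h : ∀ Q ∈ 𝒲, ∀ A ∈ 𝕍.V r, P * A * Q = 0
    · exact projSup_apply_of_mem (hF (Or.inr ⟨hP, h⟩)) x
    · push Not at h
      obtain ⟨Q, hQ, h⟩ := h
      exact habs Q hQ P (Or.inr ⟨hP, h⟩)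
  · exact habs P hP P (Or.inl rfl)

include h𝒰 in
theorem absorb_subset_projections {Q : H →L[ℂ] H} (hQ : Q ∈ projections M) :
    insert Q {P | P ∈ 𝒰 ∧ ∃ A ∈ 𝕍.V r, P * A * Q ≠ 0} ⊆ projections M :=
  Set.insert_subset hQ fun _ hP => h𝒰 hP.1

include h𝒰 h𝒲

theorem saturatedUnion_subset_projections : 𝕍.saturatedUnion 𝒰 𝒲 r ⊆ projections M := by
  rintro _ (⟨Q, hQ, rfl⟩ | hP)
  · exact projSup_mem_projections (𝕍.absorb_subset_projections h𝒰 (h𝒲 hQ))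
  · exact h𝒰 hP.1

theorem saturatedUnion_bounded (h𝕍 : 𝕍.IsReflexive)
    (ha : ∀ P ∈ 𝒰, ∀ A, P * A * P ∈ 𝕍.V a) (hc : ∀ P ∈ 𝒲, ∀ A, P * A * P ∈ 𝕍.V c) :
    ∀ P ∈ 𝕍.saturatedUnion 𝒰 𝒲 r, ∀ A, P * A * P ∈ 𝕍.V (a + r + c + r + a) := by
  have hle : c ≤ a + r + c + r + a := by
    rw [add_assoc, add_right_comm]
    exact le_add_self
  rintro _ (⟨Q, hQ, rfl⟩ | hP) A
  · refine 𝕍.projSup_mul_mul_projSup_mem_V h𝕍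
      (fun P hP => (𝕍.absorb_subset_projections h𝒰 (h𝒲 hQ) hP).2) ?_ A
    have hQ' := (h𝒲 hQ).2
    have h1 : ∀ P ∈ 𝒰, (∃ A ∈ 𝕍.V r, P * A * Q ≠ 0) → ∃ B ∈ 𝕍.V r, Q * B * P ≠ 0 := by
      rintro P hP ⟨B, hB, hne⟩
      exact ⟨star B, 𝕍.star_mem_V r B hB, (mul_mul_eq_zero_iff_star (h𝒰 hP).2 hQ').not.1 hne⟩
    -- Any two constituents of an absorbed join are linked through `Q`. The worst case, two absorbed
    -- members, passes through `P`, `Q`, `P'` and two steps of length `r`.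
    rintro P (rfl | ⟨hP, B, hB, hne⟩) P' (rfl | ⟨hP', hP''⟩) A
    · exact 𝕍.V_mono hle (hc _ hQ A)
    · obtain ⟨B, hB, hne⟩ := h1 P' hP' hP''
      refine 𝕍.V_mono ?_ (𝕍.mul_mul_mem_V_chain h𝕍 hQ' (h𝒰 hP').2 (hc P hQ) hB hne
        (ha P' hP') A)
      rw [add_assoc c, add_assoc (a + r + c), add_assoc (a + r) c]
      exact le_add_self
    · refine 𝕍.V_mono ?_ (𝕍.mul_mul_mem_V_chain h𝕍 (h𝒰 hP).2 hQ' (ha P hP) hB hne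
        (hc P' hQ) A)
      rw [add_assoc (a + r + c)]
      exact le_self_add
    · obtain ⟨B', hB', hne'⟩ := h1 P' hP' hP''
      exact 𝕍.mul_mul_mem_V_chain h𝕍 (h𝒰 hP).2 (h𝒰 hP').2
        (𝕍.mul_mul_mem_V_chain h𝕍 (h𝒰 hP).2 hQ' (ha P hP) hB hne (hc Q hQ)) hB' hne'
        (ha P' hP') A
  · exact 𝕍.V_mono le_add_self (ha _ hP.1 A)

theorem saturatedUnion_separated (ha : ∀ P ∈ 𝒰, ∀ A, P * A * P ∈ 𝕍.V a)
    (hs𝒰 : ∀ P ∈ 𝒰, ∀ Q ∈ 𝒰, P ≠ Q → ∀ A ∈ 𝕍.V r, P * A * Q = 0)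
    (hs𝒲 : ∀ P ∈ 𝒲, ∀ Q ∈ 𝒲, P ≠ Q → ∀ A ∈ 𝕍.V (r + a + r), P * A * Q = 0) :
    ∀ P ∈ 𝕍.saturatedUnion 𝒰 𝒲 r, ∀ Q ∈ 𝕍.saturatedUnion 𝒰 𝒲 r, P ≠ Q →
      ∀ A ∈ 𝕍.V r, P * A * Q = 0 := by
  -- A member of `𝒰` that is `r`-close to both `Q` and `Q'` would link them within `r + a + r`,
  -- against the separation of `𝒲`.
  have hfar : ∀ P ∈ 𝒰, ∀ Q ∈ 𝒲, ∀ Q' ∈ 𝒲, Q ≠ Q' → (∃ A ∈ 𝕍.V r, P * A * Q ≠ 0) →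
      ∀ A ∈ 𝕍.V r, P * A * Q' = 0 := by
    rintro P hP Q hQ Q' hQ' hne ⟨A, hA, hPQ⟩ B hB
    by_contra hPQ'
    rw [ne_eq, mul_mul_eq_zero_iff_star (h𝒰 hP).2 (h𝒲 hQ).2] at hPQ
    obtain ⟨C, hC, hC'⟩ :=
      𝕍.exists_mul_mul_ne_zero (𝕍.star_mem_V r A hA) hB (ha P hP) hPQ hPQ'
    exact hC' (hs𝒲 Q hQ Q' hQ' hne C hC)
  have hmixed : ∀ Q ∈ 𝒲, ∀ P ∈ 𝒰, (∀ Q ∈ 𝒲, ∀ A ∈ 𝕍.V r, P * A * Q = 0) →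
      ∀ A ∈ 𝕍.V r, P * A * 𝕍.absorb 𝒰 r Q = 0 := by
    intro Q hQ P hP hPfar A hA
    refine eq_zero_of_forall_inner fun x y => ?_
    suffices h : P * A * projSup (insert Q {P | P ∈ 𝒰 ∧ ∃ A ∈ 𝕍.V r, P * A * Q ≠ 0}) = 0 by
      rw [absorb, h]
      simp
    rw [mul_mul_eq_zero_iff_star (h𝒰 hP).2 (isStarProjection_projSup _)]
    ext z
    refine projSup_apply_eq_zero (fun R hR => (𝕍.absorb_subset_projections h𝒰 (h𝒲 hQ) hR).2) ?_
    intro R hR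
    suffices h : R * star A * P = 0 from DFunLike.congr_fun h z
    rw [← mul_mul_eq_zero_iff_star (h𝒰 hP).2 (𝕍.absorb_subset_projections h𝒰 (h𝒲 hQ) hR).2]
    rcases hR with rfl | ⟨hR, B, hB, hne⟩
    · exact hPfar R hQ A hA
    · refine hs𝒰 P hP R hR ?_ A hA
      rintro rfl
      exact hne (hPfar Q hQ B hB)
  have habs : ∀ Q ∈ 𝒲, IsStarProjection (𝕍.absorb 𝒰 r Q) := fun Q _ => isStarProjection_projSup _
  rintro _ (⟨Q, hQ, rfl⟩ | ⟨hP, hPfar⟩) _ (⟨Q', hQ', rfl⟩ | ⟨hP', hPfar'⟩) hne A hA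
  · have hQQ' : Q ≠ Q' := fun h => hne (by rw [h])
    refine projSup_mul_mul_projSup_eq_zero
      (fun P hP => (𝕍.absorb_subset_projections h𝒰 (h𝒲 hQ) hP).2)
      (fun P hP => (𝕍.absorb_subset_projections h𝒰 (h𝒲 hQ') hP).2) ?_
    rintro P (rfl | ⟨hP, hPQ⟩) P' (rfl | ⟨hP', hPQ'⟩)
    · exact hs𝒲 _ hQ _ hQ' hQQ' A (𝕍.V_mono le_add_self hA)
    · exact 𝕍.forall_mul_mul_eq_zero_symm (h𝒰 hP').2 (h𝒲 hQ).2
        (hfar P' hP' Q' hQ' P hQ hQQ'.symm hPQ') A hA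
    · exact hfar P hP Q hQ P' hQ' hQQ' hPQ A hA
    · refine hs𝒰 P hP P' hP' ?_ A hA
      -- The absorbed members differ, since one member of `𝒰` cannot be close to both `Q` and `Q'`.
      rintro rfl
      obtain ⟨B, hB, hB'⟩ := hPQ'
      exact hB' (hfar P hP Q hQ Q' hQ' hQQ' hPQ B hB)
  · exact 𝕍.forall_mul_mul_eq_zero_symm (h𝒰 hP').2 (habs Q hQ) (hmixed Q hQ _ hP' hPfar') A hA
  · exact hmixed Q' hQ' _ hP hPfar A hA
  · exact hs𝒰 _ hP _ hP' hne A hA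

end SaturatedUnion

/-! ### Passing from the metric quotients back to `M`. -/

/-- The coefficient of `R.inflate T` at `x`, `y` is that of `T` at the projected vectors, so the
vector test for the quotient yields the one for `𝒱_t`. -/
theorem quotient_isReflexive (h𝕍 : 𝕍.IsReflexive) (R : CentralProjection M) :
    (𝕍.quotient R).IsReflexive := by
  refine fun t => operatorReflexive_iff.2 fun B hB => ?_
  refine (𝕍.exists_compress_mem_V_iff R).2 (operatorReflexive_iff.1 (h𝕍 t) _ fun x y hxy => ?_)
  have h : ∀ T : R.space →L[ℂ] R.space, inner ℂ x (R.inflate T y)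
      = inner ℂ (R.space.orthogonalProjectionOnto x) (T (R.space.orthogonalProjectionOnto y)) := by
    intro T
    simp [CentralProjection.inflate]
  rw [h]
  refine hB _ _ fun A hA => ?_
  rw [← h]
  exact hxy _ ((𝕍.exists_compress_mem_V_iff R).1 hA)

theorem _root_.QMetric.CentralProjection.inflate_mem_projections (R : CentralProjection M)
    {P : R.space →L[ℂ] R.space} (hP : P ∈ projections R.algebra) :
    R.inflate P ∈ projections M := by
  refine ⟨R.exists_compress_iff.1 hP.1, ?_, ?_⟩
  · change R.inflate P * R.inflate P = R.inflate P
    rw [← R.inflate_mul, hP.2.isIdempotentElem.eq]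
  · change star (R.inflate P) = R.inflate P
    rw [← R.inflate_star, hP.2.isSelfAdjoint.star_eq]

theorem _root_.QMetric.CentralProjection.inflate_mul_mul_inflate (R : CentralProjection M)
    (P Q : R.space →L[ℂ] R.space) (A : H →L[ℂ] H) :
    R.inflate P * A * R.inflate Q = R.inflate (P * R.compress A * Q) := by
  rw [R.inflate_mul, R.inflate_mul, R.inflate_compress, mul_assoc R.op, ← mul_assoc (R.inflate P),
    R.inflate_mul_op, ← mul_assoc, mul_assoc _ R.op, R.op_mul_inflate]

theorem exists_families_of_quotient (h𝕍 : 𝕍.IsReflexive) (R : CentralProjection M) {n : ℕ}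
    (h : (𝕍.quotient R).AsdimLE n) (t : ℝ≥0) :
    ∃ (F : Fin (n + 1) → Set (H →L[ℂ] H)) (d : ℝ≥0),
      (∀ i, F i ⊆ projections M ∧ (∀ P ∈ F i, ∀ A, P * A * P ∈ 𝕍.V d) ∧
        ∀ P ∈ F i, ∀ Q ∈ F i, P ≠ Q → ∀ A ∈ 𝕍.V t, P * A * Q = 0) ∧
      ∀ x, projSup (⋃ i, F i) (R.op x) = R.op x := by
  -- Disjointness controls only displacements strictly below its scale, so scale `t + 1` is
  -- requested in order to reach `t` itself.
  obtain ⟨F, hF, hsup⟩ := h (t + 1) (by positivity)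
  choose hproj hbdd hdisj using hF
  choose d hd hbdd using hbdd
  refine ⟨fun i => R.inflate '' F i, Finset.univ.sup d, fun i => ⟨?_, ?_, ?_⟩, fun x => ?_⟩
  · rintro _ ⟨P, hP, rfl⟩
    exact R.inflate_mem_projections (hproj i hP)
  · rintro _ ⟨P, hP, rfl⟩ A
    have h1 := ((𝕍.quotient R).diam_le_iff (𝕍.quotient_isReflexive h𝕍 R)).1 (hbdd i P hP)
      (R.compress A)
    rw [R.inflate_mul_mul_inflate]
    exact 𝕍.V_mono (Finset.le_sup (Finset.mem_univ i)) ((𝕍.exists_compress_mem_V_iff R).1 h1)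
  · rintro _ ⟨P, hP, rfl⟩ _ ⟨Q, hQ, rfl⟩ hne A hA
    have hA' : ∃ B ∈ 𝕍.V t, R.compress B = R.compress A := ⟨A, hA, rfl⟩
    rw [R.inflate_mul_mul_inflate, (𝕍.quotient R).mul_mul_eq_zero_of_nhd_mul_nhd (hproj i hP).2
      (hproj i hQ).2 (hdisj i P hP Q hQ fun h => hne (by rw [h])) (lt_add_one t) hA',
      R.inflate_zero]
  · rw [projSup_apply_eq_self_iff]
    have hx : R.op x ∈ R.space := ⟨x, rfl⟩
    have h1 := projSup_apply_eq_self_iff.1 (DFunLike.congr_fun hsup ⟨R.op x, hx⟩)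
    -- The closed span inside the range of `R` is carried into the closed span in `H` by the
    -- continuous inclusion.
    have h2 : (⨆ P ∈ ⋃ i, F i, P.range).topologicalClosure ≤
        (⨆ P ∈ ⋃ i, R.inflate '' F i, P.range).topologicalClosure.comap R.space.subtype := by
      refine Submodule.topologicalClosure_minimal _ (iSup₂_le fun P hP => ?_)
        ((Submodule.isClosed_topologicalClosure _).preimage continuous_subtype_val)
      obtain ⟨i, hP⟩ := Set.mem_iUnion.1 hP
      rintro _ ⟨y, rfl⟩
      have h3 : R.inflate P (y : H) = (P y : H) := by
        simp [CentralProjection.inflate]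
      change (P y : H) ∈ (⨆ P ∈ ⋃ i, R.inflate '' F i, P.range).topologicalClosure
      rw [← h3]
      exact projSup_apply_eq_self_iff.1
        (projSup_apply_of_mem (Set.mem_iUnion.2 ⟨i, Set.mem_image_of_mem _ hP⟩) _)
    exact h2 h1

theorem asdimLE_of_quotients (h𝕍 : 𝕍.IsReflexive) {R₁ R₂ : CentralProjection M}
    (hR : projSup {R₁.op, R₂.op} = 1) {n : ℕ} (h₁ : (𝕍.quotient R₁).AsdimLE n)
    (h₂ : (𝕍.quotient R₂).AsdimLE n) : 𝕍.AsdimLE n := by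
  intro r hr
  obtain ⟨F, a, hF, hF1⟩ := 𝕍.exists_families_of_quotient h𝕍 R₁ h₁ (r + r)
  -- The second scale depends on the diameter bound `a` of the first cover; at scale `2r + a + 2r`
  -- no member of the first cover can be `2r`-close to two distinct members of the same second
  -- family.
  obtain ⟨G, c, hG, hG1⟩ := 𝕍.exists_families_of_quotient h𝕍 R₂ h₂ (r + r + a + (r + r))
  have hproj := fun i => 𝕍.saturatedUnion_subset_projections (r := r + r) (hF i).1 (hG i).1
  have hcover : ∀ i, ∀ P ∈ F i ∪ G i, ∀ x,
      projSup (⋃ i, 𝕍.saturatedUnion (F i) (G i) (r + r)) (P x) = P x := fun i P hP x =>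
    𝕍.projSup_apply_of_saturatedUnion_subset
      (Set.subset_iUnion (fun i => 𝕍.saturatedUnion (F i) (G i) (r + r)) i) hP x
  refine ⟨fun i => 𝕍.saturatedUnion (F i) (G i) (r + r), fun i => ⟨hproj i, ?_, ?_⟩, ?_⟩
  · refine ⟨a + (r + r) + c + (r + r) + a, by positivity, fun P hP => ?_⟩
    exact (𝕍.diam_le_iff h𝕍).2
      (𝕍.saturatedUnion_bounded (hF i).1 (hG i).1 h𝕍 (hF i).2.1 (hG i).2.1 P hP)
  · intro P hP Q hQ hne
    exact 𝕍.nhd_mul_nhd_eq_zero (hproj i hP).2 (hproj i hQ).2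
      (𝕍.saturatedUnion_separated (hF i).1 (hG i).1 (hF i).2.1 (hF i).2.2 (hG i).2.2 P hP Q hQ hne)
  · ext x
    refine projSup_apply_eq_self_of_forall ?_ (DFunLike.congr_fun hR x)
    rintro P (rfl | rfl) x
    · refine projSup_apply_eq_self_of_forall (fun P hP => ?_) (hF1 x)
      obtain ⟨i, hP⟩ := Set.mem_iUnion.1 hP
      exact hcover i P (Or.inl hP)
    · refine projSup_apply_eq_self_of_forall (fun P hP => ?_) (hG1 x)
      obtain ⟨i, hP⟩ := Set.mem_iUnion.1 hP
      exact hcover i P (Or.inr hP)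

/-! ### The asymptotic dimension as an attained infimum. -/

theorem AsdimLE.mono {𝕍 : QuantumMetric M} {m n : ℕ} (h : 𝕍.AsdimLE m) (hmn : m ≤ n) :
    𝕍.AsdimLE n := by
  intro r hr
  obtain ⟨F, hF, hsup⟩ := h r hr
  -- The extra indices receive empty families, which affect neither the conditions nor the join.
  refine ⟨fun i => if hi : (i : ℕ) < m + 1 then F ⟨i, hi⟩ else ∅, fun i => ?_, ?_⟩
  · by_cases hi : (i : ℕ) < m + 1
    · simpa only [hi, dif_pos] using hF ⟨i, hi⟩
    · simp only [hi, dif_neg, not_false_eq_true]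
      exact ⟨Set.empty_subset _, ⟨1, one_pos, fun P hP => hP.elim⟩, fun P hP => hP.elim⟩
  · rw [← hsup]
    congr 1
    ext P
    simp only [Set.mem_iUnion]
    constructor
    · rintro ⟨i, hP⟩
      split_ifs at hP with hi
      · exact ⟨_, hP⟩
      · exact hP.elim
    · rintro ⟨i, hP⟩
      exact ⟨⟨i, by omega⟩, by rwa [dif_pos i.2]⟩

theorem asdim_le_iff {𝕍 : QuantumMetric M} {n : ℕ} : 𝕍.asdim ≤ n ↔ 𝕍.AsdimLE n := by
  refine ⟨fun h => ?_, fun h => iInf₂_le n h⟩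
  by_contra hn
  have h1 : ((n + 1 : ℕ) : ℕ∞) ≤ 𝕍.asdim := by
    refine le_iInf₂ fun m hm => ?_
    by_contra! hlt
    exact hn (hm.mono (Nat.lt_succ_iff.1 (by exact_mod_cast hlt)))
  have h2 : n + 1 ≤ n := by exact_mod_cast h1.trans h
  omega

end QuantumMetric

end QMetric

theorem mainTheorem6 {H : Type*} [NormedAddCommGroup H] [InnerProductSpace ℂ H] [CompleteSpace H]
    (M : VonNeumannAlgebra H) (𝕍 : QMetric.QuantumMetric M) (h𝕍 : 𝕍.IsReflexive)
    (R₁ R₂ : QMetric.CentralProjection M) (hR : QMetric.projSup {R₁.op, R₂.op} = 1) :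
    𝕍.asdim ≤ max (𝕍.quotient R₁).asdim (𝕍.quotient R₂).asdim := by
  cases h : max (𝕍.quotient R₁).asdim (𝕍.quotient R₂).asdim with
  | top => exact le_top
  | coe n =>
    rw [QMetric.QuantumMetric.asdim_le_iff]
    exact 𝕍.asdimLE_of_quotients h𝕍 hR
      (QMetric.QuantumMetric.asdim_le_iff.1 ((le_max_left _ _).trans h.le))
      (QMetric.QuantumMetric.asdim_le_iff.1 ((le_max_right _ _).trans h.le))
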